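/- Let $1<p<\infty$, let $q$ be the conjugate exponent, $\frac1p+\frac1q=1$, and let $C_1$ be the finite continuous Cesàro operator on the complex Banach space $L^p[0,1]$ (a bounded linear operator), $$(C_1f)(x)=\frac1x\int_0^x f(t)\,dt .$$ For a bounded linear operator $T$ on a complex Banach space, let $\sigma_p(T)$ be its point spectrum (the set of its eigenvalues). A number $\lambda\in\mathbb C$ is an extended eigenvalue of $T$ if there is a bounded linear operator $X\neq 0$ with $TX=\lambda XT$. The operator $T$ has rich point spectrum if $\sigma_p(T)$ has non-empty interior and, for every open disc $D\subseteq\sigma_p(T)$, the set $\bigcup_{z\in D}\ker(T-z)$ has dense linear span. Then: 1. the point spectrum of $C_1$ is the open disc of centre $q/2$ and radius $q/2$; 2. $C_1$ has rich point spectrum; 3. if $\lambda\in\mathbb C$ is an extended eigenvalue of $C_1$, then $\lambda$ is real and $0<\lambda\le 1$; 4. the set of extended eigenvalues of $C_1$ is exactly the interval $(0,1]$. -/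

import Mathlib

open MeasureTheory Set Metric
open scoped ENNReal

namespace ExtendedEigenvalues

section General

variable {E : Type*} [NormedAddCommGroup E] [NormedSpace ℂ E]

/-- `lam` is an extended eigenvalue of the bounded operator `T` if `T X = lam X T` for some
nonzero bounded operator `X`. -/
def IsExtendedEigenvalue (T : E →L[ℂ] E) (lam : ℂ) : Prop :=
  ∃ X : E →L[ℂ] E, X ≠ 0 ∧ T ∘L X = lam • (X ∘L T)

/-- The point spectrum: the set of all eigenvalues. -/
def pointSpectrum (T : E →L[ℂ] E) : Set ℂ :=
  {z | Module.End.HasEigenvalue (T : E →ₗ[ℂ] E) z}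

/-- `T` has rich point spectrum if its point spectrum has nonempty interior and, for every open
disc `D` contained in the point spectrum, the union over `z ∈ D` of the spaces `ker (T - z)` is a
total set, that is, its linear span is dense. -/
def HasRichPointSpectrum (T : E →L[ℂ] E) : Prop :=
  (interior (pointSpectrum T)).Nonempty ∧
    ∀ (c : ℂ) (r : ℝ), 0 < r → ball c r ⊆ pointSpectrum T →
      Dense (Submodule.span ℂ
        (⋃ z ∈ ball c r, (Module.End.eigenspace (T : E →ₗ[ℂ] E) z : Set E)) : Set E)

end General

section Cesaro

/-- Lebesgue measure on `[0, 1]`. -/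
noncomputable abbrev unitMeasure : Measure ℝ := volume.restrict (Icc (0 : ℝ) 1)

/-- The integral means `x ↦ (1 / x) ∫₀ˣ f`. -/
noncomputable def average (f : ℝ → ℂ) (x : ℝ) : ℂ := (1 / (x : ℂ)) * ∫ t in (0 : ℝ)..x, f t

theorem lintegral_rpow_left {a x : ℝ} (ha : -1 < a) (hx : 0 ≤ x) :
    ∫⁻ t in Ioc 0 x, ENNReal.ofReal (t ^ a) = ENNReal.ofReal (x ^ (a + 1) / (a + 1)) := by
  have hi : IntegrableOn (fun t : ℝ => t ^ a) (Ioc 0 x) volume := by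
    have := intervalIntegral.intervalIntegrable_rpow' (a := 0) (b := x) ha
    rwa [intervalIntegrable_iff_integrableOn_Ioc_of_le hx] at this
  rw [← ofReal_integral_eq_lintegral_ofReal hi, ← intervalIntegral.integral_of_le hx,
    integral_rpow (Or.inl ha), Real.zero_rpow (by linarith), sub_zero]
  filter_upwards [ae_restrict_mem measurableSet_Ioc] with t ht
  exact Real.rpow_nonneg ht.1.le _

theorem lintegral_rpow_right {b t : ℝ} (hb : 0 < b) (ht : 0 < t) (ht1 : t ≤ 1) :
    ∫⁻ x in Icc t 1, ENNReal.ofReal (x ^ (-1 - b)) ≤ ENNReal.ofReal (t ^ (-b) / b) := by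
  have h0 : (0 : ℝ) ∉ uIcc t 1 := by
    rw [uIcc_of_le ht1]; intro h; linarith [h.1]
  have hi : IntegrableOn (fun x : ℝ => x ^ (-1 - b)) (Ioc t 1) volume := by
    have := intervalIntegral.intervalIntegrable_rpow (μ := volume) (r := -1 - b) (Or.inr h0)
    rwa [intervalIntegrable_iff_integrableOn_Ioc_of_le ht1] at this
  rw [setLIntegral_congr Ioc_ae_eq_Icc.symm,
    ← ofReal_integral_eq_lintegral_ofReal hi, ← intervalIntegral.integral_of_le ht1,
    integral_rpow (Or.inr ⟨by linarith, h0⟩)]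
  · apply ENNReal.ofReal_le_ofReal
    have : -1 - b + 1 = -b := by ring
    rw [this, Real.one_rpow, div_neg, ← neg_div, neg_sub]
    gcongr
    linarith
  · filter_upwards [ae_restrict_mem measurableSet_Ioc] with x hx
    exact Real.rpow_nonneg (ht.trans hx.1).le _

theorem hardy_pointwise {p q : ℝ} (hpq : p.HolderConjugate q) {g : ℝ → ℝ≥0∞}
    (hg : Measurable g) {x : ℝ} (hx : 0 < x) :
    (ENNReal.ofReal x⁻¹ * ∫⁻ t in Ioc 0 x, g t) ^ p ≤
      ENNReal.ofReal (q ^ (p - 1) * x ^ (-1 - 1 / q)) *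
        ∫⁻ t in Ioc 0 x, g t ^ p * ENNReal.ofReal (t ^ (1 / q)) := by
  have hp0 : 0 < p := hpq.pos
  have hq0 : 0 < q := hpq.symm.pos
  have hsum : 1 / p + 1 / q = 1 := by simpa using hpq.inv_add_inv_eq_one
  have hp1 : 1 / p = 1 - 1 / q := by linarith
  have hpq' : p / q = p - 1 := by
    have : p * (1 / p + 1 / q) = p * 1 := by rw [hsum]
    field_simp at this ⊢
    linarith
  have hH := ENNReal.lintegral_mul_le_Lp_mul_Lq (volume.restrict (Ioc 0 x)) hpq
    (f := fun t => g t * ENNReal.ofReal (t ^ (1 / (p * q))))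
    (g := fun t => ENNReal.ofReal (t ^ (-(1 / (p * q)))))
    (by fun_prop) (by fun_prop)
  have e1 : ∫⁻ t in Ioc 0 x, ((fun t => g t * ENNReal.ofReal (t ^ (1 / (p * q)))) *
      (fun t => ENNReal.ofReal (t ^ (-(1 / (p * q)))))) t = ∫⁻ t in Ioc 0 x, g t := by
    refine setLIntegral_congr_fun measurableSet_Ioc fun t ht => ?_
    have ht0 : 0 < t := ht.1
    simp only [Pi.mul_apply]
    rw [mul_assoc, ← ENNReal.ofReal_mul (Real.rpow_nonneg ht0.le _), ← Real.rpow_add ht0]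
    simp
  have e2 : ∫⁻ t in Ioc 0 x, (g t * ENNReal.ofReal (t ^ (1 / (p * q)))) ^ p =
      ∫⁻ t in Ioc 0 x, g t ^ p * ENNReal.ofReal (t ^ (1 / q)) := by
    refine setLIntegral_congr_fun measurableSet_Ioc fun t ht => ?_
    have ht0 : 0 < t := ht.1
    rw [ENNReal.mul_rpow_of_nonneg _ _ hp0.le,
      ENNReal.ofReal_rpow_of_nonneg (Real.rpow_nonneg ht0.le _) hp0.le, ← Real.rpow_mul ht0.le]
    congr 3
    field_simp
  have e3 : ∫⁻ t in Ioc 0 x, (ENNReal.ofReal (t ^ (-(1 / (p * q))))) ^ q =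
      ENNReal.ofReal (q * x ^ (1 / q)) := by
    have : ∫⁻ t in Ioc 0 x, (ENNReal.ofReal (t ^ (-(1 / (p * q))))) ^ q =
        ∫⁻ t in Ioc 0 x, ENNReal.ofReal (t ^ (-(1 / p))) := by
      refine setLIntegral_congr_fun measurableSet_Ioc fun t ht => ?_
      have ht0 : 0 < t := ht.1
      rw [ENNReal.ofReal_rpow_of_nonneg (Real.rpow_nonneg ht0.le _) hq0.le,
        ← Real.rpow_mul ht0.le]
      congr 2
      field_simp
    have hq1 : 0 < 1 / q := by positivity
    rw [this, lintegral_rpow_left (by linarith) hx.le]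
    have : -(1 / p) + 1 = 1 / q := by linarith
    rw [this]
    congr 1
    field_simp
  rw [e1, e2, e3] at hH
  calc (ENNReal.ofReal x⁻¹ * ∫⁻ t in Ioc 0 x, g t) ^ p
      ≤ (ENNReal.ofReal x⁻¹ *
        ((∫⁻ t in Ioc 0 x, g t ^ p * ENNReal.ofReal (t ^ (1 / q))) ^ (1 / p) *
          ENNReal.ofReal (q * x ^ (1 / q)) ^ (1 / q))) ^ p := by gcongr
    _ = _ := by
      have hqx : 0 ≤ q * x ^ (1 / q) := by positivity
      rw [ENNReal.mul_rpow_of_nonneg _ _ hp0.le, ENNReal.mul_rpow_of_nonneg _ _ hp0.le,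
        ← ENNReal.rpow_mul, one_div_mul_cancel hp0.ne', ENNReal.rpow_one, ← ENNReal.rpow_mul,
        ENNReal.ofReal_rpow_of_nonneg (by positivity) hp0.le,
        ENNReal.ofReal_rpow_of_nonneg hqx (by positivity), mul_comm (lintegral _ _), ← mul_assoc,
        ← ENNReal.ofReal_mul (by positivity)]
      congr 2
      have h1 : 1 / q * p = p - 1 := by rw [← hpq']; ring
      rw [h1, Real.mul_rpow hq0.le (by positivity), ← Real.rpow_mul hx.le,
        ← Real.rpow_neg_one x, ← Real.rpow_mul hx.le, mul_left_comm, ← Real.rpow_add hx]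
      congr 2
      rw [mul_sub, h1]
      ring

theorem hardy {p q : ℝ} (hpq : p.HolderConjugate q) {g : ℝ → ℝ≥0∞} (hg : Measurable g) :
    ∫⁻ x in Ioc 0 1, (ENNReal.ofReal x⁻¹ * ∫⁻ t in Ioc 0 x, g t) ^ p ≤
      ENNReal.ofReal (q ^ p) * ∫⁻ t in Ioc 0 1, g t ^ p := by
  have hp0 : 0 < p := hpq.pos
  have hq0 : 0 < q := hpq.symm.pos
  let k : ℝ → ℝ≥0∞ := fun x => ENNReal.ofReal (q ^ (p - 1) * x ^ (-1 - 1 / q))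
  let h : ℝ → ℝ≥0∞ := fun t => g t ^ p * ENNReal.ofReal (t ^ (1 / q))
  have hk : Measurable k := by fun_prop
  have hh : Measurable h := by fun_prop
  let S : Set (ℝ × ℝ) := {z | z.2 ≤ z.1}
  have hS : MeasurableSet S := measurableSet_le measurable_snd measurable_fst
  let F : ℝ → ℝ → ℝ≥0∞ := fun x t => S.indicator (fun z => k z.1 * h z.2) (x, t)
  have hF : Measurable (Function.uncurry F) := by
    have : Measurable (fun z : ℝ × ℝ => k z.1 * h z.2) := by fun_prop
    exact this.indicator hS
  calc ∫⁻ x in Ioc 0 1, (ENNReal.ofReal x⁻¹ * ∫⁻ t in Ioc 0 x, g t) ^ p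
      ≤ ∫⁻ x in Ioc 0 1, ∫⁻ t in Ioc 0 1, F x t := by
        refine setLIntegral_mono' measurableSet_Ioc fun x hx => ?_
        refine (hardy_pointwise hpq hg hx.1).trans ?_
        rw [← lintegral_const_mul _ hh]
        calc ∫⁻ t in Ioc 0 x, k x * h t = ∫⁻ t in Ioc 0 x, F x t := by
              refine setLIntegral_congr_fun measurableSet_Ioc fun t ht => ?_
              have : (x, t) ∈ S := ht.2
              simp [F, this]
          _ ≤ _ := lintegral_mono_set (Ioc_subset_Ioc_right hx.2)
    _ = ∫⁻ t in Ioc 0 1, ∫⁻ x in Ioc 0 1, F x t := lintegral_lintegral_swap hF.aemeasurable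
    _ ≤ ∫⁻ t in Ioc 0 1, ENNReal.ofReal (q ^ p) * g t ^ p := by
        refine setLIntegral_mono' measurableSet_Ioc fun t ht => ?_
        have ht0 : 0 < t := ht.1
        calc ∫⁻ x in Ioc 0 1, F x t
            = ∫⁻ x in Ioc 0 1, (Ici t).indicator (fun x => k x * h t) x := by
              refine lintegral_congr fun x => ?_
              simp only [F, S, indicator, mem_ofPred_eq, mem_Ici]
          _ = ∫⁻ x in Ici t ∩ Ioc 0 1, k x * h t := by
              rw [lintegral_indicator measurableSet_Ici, Measure.restrict_restrict measurableSet_Ici]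
          _ ≤ ∫⁻ x in Icc t 1, k x * h t := lintegral_mono_set fun x hx => ⟨hx.1, hx.2.2⟩
          _ = (ENNReal.ofReal (q ^ (p - 1)) *
                ∫⁻ x in Icc t 1, ENNReal.ofReal (x ^ (-1 - 1 / q))) * h t := by
              rw [lintegral_mul_const _ hk, ← lintegral_const_mul _ (by fun_prop)]
              congr 1
              refine lintegral_congr fun x => ?_
              exact ENNReal.ofReal_mul (by positivity)
          _ ≤ (ENNReal.ofReal (q ^ (p - 1)) * ENNReal.ofReal (t ^ (-(1 / q)) / (1 / q))) * h t := by
              gcongr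
              exact lintegral_rpow_right (by positivity) ht0 ht.2
          _ = ENNReal.ofReal (q ^ p) * g t ^ p := by
              simp only [h]
              rw [← ENNReal.ofReal_mul (by positivity), mul_comm (g t ^ p), ← mul_assoc,
                ← ENNReal.ofReal_mul (by positivity)]
              congr 2
              rw [Real.rpow_sub_one hq0.ne', Real.rpow_neg ht0.le]
              have : t ^ (1 / q) ≠ 0 := by positivity
              field_simp
    _ = _ := lintegral_const_mul _ (by fun_prop)

variable {p : ℝ≥0∞}

theorem intervalIntegrable_of_memLp (hp : 1 ≤ p) {f : ℝ → ℂ} (hf : MemLp f p unitMeasure) {x : ℝ}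
    (hx : x ∈ Icc (0 : ℝ) 1) : IntervalIntegrable f volume 0 x := by
  rw [intervalIntegrable_iff_integrableOn_Ioc_of_le hx.1]
  have h : IntegrableOn f (Icc 0 1) volume := hf.integrable hp
  exact h.mono_set fun t ht => ⟨ht.1.le, ht.2.trans hx.2⟩

theorem aestronglyMeasurable_average (hp : 1 ≤ p) {f : ℝ → ℂ} (hf : MemLp f p unitMeasure) :
    AEStronglyMeasurable (average f) unitMeasure := by
  have h : IntegrableOn f (uIcc 0 1) volume := by
    rw [uIcc_of_le zero_le_one]; exact hf.integrable hp
  have hc := intervalIntegral.continuousOn_primitive_interval h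
  rw [uIcc_of_le zero_le_one] at hc
  have h1 : Measurable fun x : ℝ => 1 / (x : ℂ) := by fun_prop
  exact h1.aestronglyMeasurable.mul (hc.aestronglyMeasurable measurableSet_Icc)

theorem average_congr {f g : ℝ → ℂ} (h : f =ᵐ[unitMeasure] g) {x : ℝ} (hx : x ∈ Icc (0 : ℝ) 1) :
    average f x = average g x := by
  unfold average
  congr 1
  rw [intervalIntegral.integral_of_le hx.1, intervalIntegral.integral_of_le hx.1]
  refine integral_congr_ae ?_
  have hs : Ioc 0 x ⊆ Icc (0 : ℝ) 1 := fun t ht => ⟨ht.1.le, ht.2.trans hx.2⟩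
  exact ae_restrict_of_ae_restrict_of_subset hs h

theorem eLpNorm_average_le (hp1 : 1 < p) (hp : p ≠ ∞) {f : ℝ → ℂ} (hf : Measurable f) :
    eLpNorm (average f) p unitMeasure ≤
      ENNReal.ofReal (Real.conjExponent p.toReal) * eLpNorm f p unitMeasure := by
  have hr1 : 1 < p.toReal := by
    rw [← ENNReal.toReal_one]; exact (ENNReal.toReal_lt_toReal ENNReal.one_ne_top hp).2 hp1
  set r := p.toReal with hr
  set q := Real.conjExponent r with hq
  have hpq : r.HolderConjugate q := Real.HolderConjugate.conjExponent hr1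
  have hr0 : 0 < r := hpq.pos
  have hq0 : 0 < q := hpq.symm.pos
  have hp0 : p ≠ 0 := (zero_lt_one.trans hp1).ne'
  rw [eLpNorm_eq_lintegral_rpow_enorm_toReal hp0 hp, eLpNorm_eq_lintegral_rpow_enorm_toReal hp0 hp,
    ← hr, setLIntegral_congr Ioc_ae_eq_Icc.symm, setLIntegral_congr Ioc_ae_eq_Icc.symm]
  have key : ∫⁻ x in Ioc (0 : ℝ) 1, ‖average f x‖ₑ ^ r ≤
      ENNReal.ofReal (q ^ r) * ∫⁻ t in Ioc (0 : ℝ) 1, ‖f t‖ₑ ^ r := by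
    refine le_trans ?_ (hardy hpq hf.enorm)
    refine setLIntegral_mono' measurableSet_Ioc fun x hx => ?_
    refine ENNReal.rpow_le_rpow ?_ hr0.le
    rw [average, enorm_mul, intervalIntegral.integral_of_le hx.1.le]
    refine mul_le_mul' ?_ (enorm_integral_le_lintegral_enorm _)
    rw [← ofReal_norm]
    refine ENNReal.ofReal_le_ofReal (le_of_eq ?_)
    simp [abs_of_pos hx.1]
  calc _ ≤ (ENNReal.ofReal (q ^ r) * ∫⁻ t in Ioc (0 : ℝ) 1, ‖f t‖ₑ ^ r) ^ (1 / r) := by gcongr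
    _ = _ := by
      rw [ENNReal.mul_rpow_of_nonneg _ _ (by positivity),
        ENNReal.ofReal_rpow_of_nonneg (by positivity) (by positivity), ← Real.rpow_mul hq0.le,
        mul_one_div_cancel hr0.ne', Real.rpow_one]

theorem eLpNorm_average_Lp_le [Fact (1 ≤ p)] (hp1 : 1 < p) (hp : p ≠ ∞)
    (f : Lp ℂ p unitMeasure) :
    eLpNorm (average f) p unitMeasure ≤
      ENNReal.ofReal (Real.conjExponent p.toReal) * eLpNorm f p unitMeasure :=
  eLpNorm_average_le hp1 hp (Lp.stronglyMeasurable f).measurable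

theorem memLp_average [Fact (1 ≤ p)] (hp1 : 1 < p) (hp : p ≠ ∞) (f : Lp ℂ p unitMeasure) :
    MemLp (average f) p unitMeasure :=
  ⟨aestronglyMeasurable_average hp1.le (Lp.memLp f),
    (eLpNorm_average_Lp_le hp1 hp f).trans_lt
      (ENNReal.mul_lt_top ENNReal.ofReal_lt_top (Lp.memLp f).2)⟩

/-- The finite continuous Cesàro operator `(C₁ f)(x) = (1 / x) ∫₀ˣ f(t) dt`, as a bounded linear
operator on `L^p[0, 1]`, `1 < p < ∞`. -/
noncomputable def cesaro (p : ℝ≥0∞) [Fact (1 ≤ p)] (hp1 : 1 < p) (hp : p ≠ ∞) :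
    Lp ℂ p unitMeasure →L[ℂ] Lp ℂ p unitMeasure :=
  LinearMap.mkContinuous
    { toFun := fun f => (memLp_average hp1 hp f).toLp (average f)
      map_add' := fun f g => by
        rw [← MemLp.toLp_add, MemLp.toLp_eq_toLp_iff]
        filter_upwards [ae_restrict_mem measurableSet_Icc] with x hx
        rw [average_congr (Lp.coeFn_add f g) hx, Pi.add_apply, average, average, average,
          ← mul_add, ← intervalIntegral.integral_add
            (intervalIntegrable_of_memLp hp1.le (Lp.memLp f) hx)
            (intervalIntegrable_of_memLp hp1.le (Lp.memLp g) hx)]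
        rfl
      map_smul' := fun c f => by
        rw [RingHom.id_apply, ← MemLp.toLp_const_smul, MemLp.toLp_eq_toLp_iff]
        filter_upwards [ae_restrict_mem measurableSet_Icc] with x hx
        rw [average_congr (Lp.coeFn_smul c f) hx, Pi.smul_apply, average, average, smul_eq_mul,
          mul_left_comm c, ← intervalIntegral.integral_const_mul c]
        rfl }
    (Real.conjExponent p.toReal) (fun f => by
      have hr1 : 1 < p.toReal := by
        rw [← ENNReal.toReal_one]; exact (ENNReal.toReal_lt_toReal ENNReal.one_ne_top hp).2 hp1
      have hq0 : 0 ≤ Real.conjExponent p.toReal :=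
        (Real.HolderConjugate.conjExponent hr1).symm.pos.le
      have h := ENNReal.toReal_mono
        (ENNReal.mul_lt_top ENNReal.ofReal_lt_top (Lp.memLp f).2).ne
        (eLpNorm_average_Lp_le hp1 hp f)
      rw [ENNReal.toReal_mul, ENNReal.toReal_ofReal hq0] at h
      rw [LinearMap.coe_mk, AddHom.coe_mk, Lp.norm_toLp, Lp.norm_def f]
      exact h)

theorem cesaro_apply_ae [Fact (1 ≤ p)] (hp1 : 1 < p) (hp : p ≠ ∞) (f : Lp ℂ p unitMeasure) :
    cesaro p hp1 hp f =ᵐ[unitMeasure] fun x => (1 / (x : ℂ)) * ∫ t in (0 : ℝ)..x, f t :=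
  (memLp_average hp1 hp f).coeFn_toLp

end Cesaro

end ExtendedEigenvalues

namespace ExtendedEigenvalues

/-! Everything is read off from the power functions `x ^ (w - 1)`, on which averaging acts as
multiplication by `1 / w`. They lie in `L^p` exactly when `q⁻¹ < w.re`, and inversion carries this
half-plane to the disc of centre and radius `q / 2`. Conversely, the primitive `F` of an
eigenfunction satisfies `F = z x F'`, hence `F = c x ^ z⁻¹`, so there are no other eigenvalues
(`memLp_powFun_of_cesaro_eq`).

Richness is the identity theorem: `w ↦ x ^ (w - 1)` is holomorphic into `L^p`
(`differentiableAt_powLp`), so a closed subspace containing these functions for `w` near one point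
contains them all, in particular the monomials, which span a dense subspace
(`dense_span_eigenspaces`).

If `T X = lam X T`, then `X` maps `ker (T - z)` into `ker (T - lam z)`. Were the latter zero for all
`z` in a small disc of eigenvalues, `X` would vanish on a total set. Hence multiplication by `lam⁻¹`
sends the open half-plane into its closure, which forces `lam⁻¹` to be real and at least `1`.
Conversely, for `1 ≤ a` the operator `f ↦ x ^ (a - 1) f (x ^ a)` sends the function of parameter `w`
to that of parameter `a w`, and so realises `lam = a⁻¹`. -/

theorem ae_unitMeasure_mem_Ioo : ∀ᵐ x ∂unitMeasure, x ∈ Ioo (0 : ℝ) 1 := by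
  rw [unitMeasure, ← restrict_Ioo_eq_restrict_Icc]
  exact ae_restrict_mem measurableSet_Ioo

theorem toReal_pos_of_one_lt {p : ℝ≥0∞} (hp1 : 1 < p) (hp : p ≠ ∞) : 0 < p.toReal :=
  ENNReal.toReal_pos (zero_lt_one.trans hp1).ne' hp

/-! ### Power functions in `L^p[0, 1]` -/

theorem memLp_rpow_iff {p : ℝ≥0∞} (hp1 : 1 < p) (hp : p ≠ ∞) (s : ℝ) :
    MemLp (fun x : ℝ => x ^ s) p unitMeasure ↔ -1 < s * p.toReal := by
  rw [← integrable_norm_rpow_iff (by fun_prop) (zero_lt_one.trans hp1).ne' hp,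
    ← intervalIntegral.integrableOn_Ioo_rpow_iff zero_lt_one, IntegrableOn,
    restrict_Ioo_eq_restrict_Icc]
  refine integrable_congr ?_
  filter_upwards [ae_unitMeasure_mem_Ioo] with x hx
  rw [Real.norm_of_nonneg (Real.rpow_nonneg hx.1.le _), ← Real.rpow_mul hx.1.le]

/-- The power function `x ↦ x ^ (w - 1)`, an eigenfunction of the averaging operator for the
eigenvalue `1 / w`. -/
noncomputable def powFun (w : ℂ) (x : ℝ) : ℂ := (x : ℂ) ^ (w - 1)

theorem measurable_powFun (w : ℂ) : Measurable (powFun w) := by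
  unfold powFun
  fun_prop

theorem norm_powFun (w : ℂ) {x : ℝ} (hx : 0 < x) : ‖powFun w x‖ = x ^ (w.re - 1) := by
  rw [powFun, Complex.norm_cpow_eq_rpow_re_of_pos hx]
  simp

theorem memLp_powFun_iff {p : ℝ≥0∞} (hp1 : 1 < p) (hp : p ≠ ∞) {q : ℝ}
    (hpq : p.toReal.HolderConjugate q) (w : ℂ) :
    MemLp (powFun w) p unitMeasure ↔ q⁻¹ < w.re := by
  have hr := toReal_pos_of_one_lt hp1 hp
  have h1 := hpq.inv_add_inv_eq_one
  have h2 : p.toReal * p.toReal⁻¹ = 1 := mul_inv_cancel₀ hr.ne'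
  -- The critical exponent: `1 - 1 / p = 1 / q`.
  have h3 : q⁻¹ < w.re ↔ -1 < (w.re - 1) * p.toReal := by
    constructor <;> intro h <;> nlinarith
  rw [h3, ← memLp_rpow_iff hp1 hp]
  refine memLp_congr_norm (measurable_powFun w).aestronglyMeasurable (by fun_prop) ?_
  filter_upwards [ae_unitMeasure_mem_Ioo] with x hx
  rw [norm_powFun w hx.1, Real.norm_of_nonneg (Real.rpow_nonneg hx.1.le _)]

theorem average_powFun {w : ℂ} (hw : 0 < w.re) {x : ℝ} (hx : 0 < x) :
    average (powFun w) x = w⁻¹ * powFun w x := by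
  have hx' : (x : ℂ) ≠ 0 := by exact_mod_cast hx.ne'
  have hw0 : w ≠ 0 := by rintro rfl; simp at hw
  rw [average]
  simp only [powFun]
  rw [integral_cpow (Or.inl (by simpa using hw))]
  simp only [sub_add_cancel, Complex.ofReal_zero, Complex.zero_cpow hw0, sub_zero,
    Complex.cpow_sub _ _ hx', Complex.cpow_one]
  field_simp

open scoped Classical in
/-- The power function `x ↦ x ^ (w - 1)` as an element of `L^p[0, 1]`, zero if it is not
`p`-integrable. -/
noncomputable def powLp (p : ℝ≥0∞) (w : ℂ) : Lp ℂ p unitMeasure :=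
  if h : MemLp (powFun w) p unitMeasure then h.toLp _ else 0

theorem coeFn_powLp {p : ℝ≥0∞} {w : ℂ} (h : MemLp (powFun w) p unitMeasure) :
    powLp p w =ᵐ[unitMeasure] powFun w := by
  rw [powLp, dif_pos h]
  exact h.coeFn_toLp

theorem powLp_ne_zero {p : ℝ≥0∞} {w : ℂ} (h : MemLp (powFun w) p unitMeasure) :
    powLp p w ≠ 0 := by
  intro h0
  have h1 := coeFn_powLp h
  rw [h0] at h1
  have h2 : ∀ᵐ x ∂unitMeasure, False := by
    filter_upwards [h1, Lp.coeFn_zero ℂ p unitMeasure, ae_unitMeasure_mem_Ioo] with x hx hx0 hxI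
    rw [hx0, Pi.zero_apply, powFun, eq_comm, Complex.cpow_eq_zero_iff] at hx
    exact hxI.1.ne' (by exact_mod_cast hx.1)
  rw [Filter.eventually_false_iff_eq_bot, ae_eq_bot] at h2
  simp [unitMeasure, Measure.restrict_eq_zero] at h2

/-! ### The eigenvalue equation -/

section

variable {p : ℝ≥0∞} [Fact (1 ≤ p)]

theorem cesaro_powLp (hp1 : 1 < p) (hp : p ≠ ∞) {w : ℂ} (h : MemLp (powFun w) p unitMeasure)
    (hw : 0 < w.re) :
    cesaro p hp1 hp (powLp p w) = w⁻¹ • powLp p w := by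
  refine Lp.ext ?_
  filter_upwards [cesaro_apply_ae hp1 hp (powLp p w), Lp.coeFn_smul w⁻¹ (powLp p w),
    coeFn_powLp h, ae_unitMeasure_mem_Ioo] with x h1 h2 h3 hx
  rw [h1, h2, Pi.smul_apply, h3, smul_eq_mul, ← average_powFun hw hx.1,
    ← average_congr (coeFn_powLp h) (Ioo_subset_Icc_self hx), average]

theorem ae_hasDerivAt_primitive (f : Lp ℂ p unitMeasure) :
    ∀ᵐ x ∂unitMeasure, HasDerivAt (fun x => ∫ t in (0 : ℝ)..x, f t) (f x) x := by
  have h := (intervalIntegrable_of_memLp Fact.out (Lp.memLp f)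
    (right_mem_Icc.2 zero_le_one)).ae_hasDerivAt_integral
  filter_upwards [ae_restrict_of_ae h, ae_restrict_mem measurableSet_Icc] with x hx hxI
  rw [uIcc_of_le zero_le_one] at hx
  exact hx hxI 0 (left_mem_Icc.2 zero_le_one)

theorem continuousOn_primitive (f : Lp ℂ p unitMeasure) :
    ContinuousOn (fun x => ∫ t in (0 : ℝ)..x, f t) (Ioo 0 1) := by
  have h : IntegrableOn f (uIcc 0 1) volume := by
    rw [uIcc_of_le zero_le_one]; exact (Lp.memLp f).integrable Fact.out
  have hc := intervalIntegral.continuousOn_primitive_interval h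
  rw [uIcc_of_le zero_le_one] at hc
  exact hc.mono Ioo_subset_Icc_self

/-- By Lebesgue differentiation, `f` is almost everywhere the derivative of its primitive. -/
theorem eq_zero_of_primitive_eq_zero {f : Lp ℂ p unitMeasure}
    (h : ∀ x ∈ Ioo (0 : ℝ) 1, ∫ t in (0 : ℝ)..x, f t = 0) : f = 0 := by
  rw [Lp.eq_zero_iff_ae_eq_zero]
  filter_upwards [ae_hasDerivAt_primitive f, ae_unitMeasure_mem_Ioo] with x hx hxI
  have h0 : HasDerivAt (fun x => ∫ t in (0 : ℝ)..x, f t) 0 x :=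
    (hasDerivAt_const x (0 : ℂ)).congr_of_eventuallyEq
      (Filter.eventually_of_mem (Ioo_mem_nhds hxI.1 hxI.2) h)
  exact hx.unique h0

theorem primitive_ae_eq_of_cesaro_eq (hp1 : 1 < p) (hp : p ≠ ∞) {f : Lp ℂ p unitMeasure} {z : ℂ}
    (h : cesaro p hp1 hp f = z • f) :
    ∀ᵐ x ∂unitMeasure, ∫ t in (0 : ℝ)..x, f t = z * x * f x := by
  have h1 := cesaro_apply_ae hp1 hp f
  rw [h] at h1
  filter_upwards [h1, Lp.coeFn_smul z f, ae_unitMeasure_mem_Ioo] with x h1 h2 hx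
  have hx' : (x : ℂ) ≠ 0 := by exact_mod_cast hx.1.ne'
  rw [h2, Pi.smul_apply, smul_eq_mul] at h1
  have h3 : z * x * f x = x * (z * f x) := by ring
  rw [h3, h1]
  field_simp

/-- For `z = 0` the primitive vanishes almost everywhere, hence by continuity on all of `(0, 1)`. -/
theorem eigenvalue_ne_zero (hp1 : 1 < p) (hp : p ≠ ∞) {f : Lp ℂ p unitMeasure} (hf : f ≠ 0) {z : ℂ}
    (h : cesaro p hp1 hp f = z • f) : z ≠ 0 := by
  rintro rfl
  refine hf (eq_zero_of_primitive_eq_zero ?_)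
  have h1 := primitive_ae_eq_of_cesaro_eq hp1 hp h
  refine Measure.eqOn_open_of_ae_eq (μ := volume) (g := fun _ => (0 : ℂ)) ?_ isOpen_Ioo
    (continuousOn_primitive f) continuousOn_const
  filter_upwards [ae_restrict_of_ae_restrict_of_subset Ioo_subset_Icc_self h1] with x hx
  simpa using hx

/-- A regularity bootstrap: `f` agrees almost everywhere with `F / (z t)`, which is continuous on
`(0, 1)`, so its primitive `F` is differentiable at every point and not just almost everywhere. -/
theorem hasDerivAt_primitive_of_cesaro_eq (hp1 : 1 < p) (hp : p ≠ ∞) {f : Lp ℂ p unitMeasure}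
    {z : ℂ} (hz : z ≠ 0)
    (h : cesaro p hp1 hp f = z • f) {x : ℝ} (hx : x ∈ Ioo (0 : ℝ) 1) :
    HasDerivAt (fun x => ∫ t in (0 : ℝ)..x, f t) ((∫ t in (0 : ℝ)..x, f t) / (z * x)) x := by
  set F : ℝ → ℂ := fun x => ∫ t in (0 : ℝ)..x, f t with hF
  have hae : ∀ᵐ t ∂unitMeasure, f t = F t / (z * t) := by
    filter_upwards [primitive_ae_eq_of_cesaro_eq hp1 hp h, ae_unitMeasure_mem_Ioo] with t ht htI
    have ht' : (t : ℂ) ≠ 0 := by exact_mod_cast htI.1.ne'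
    rw [hF]
    simp only [ht]
    field_simp
  have hgc : ContinuousOn (fun t : ℝ => F t / (z * t)) (Ioo 0 1) := by
    refine (continuousOn_primitive f).div (by fun_prop) fun t ht => ?_
    exact mul_ne_zero hz (by exact_mod_cast ht.1.ne')
  have hsub : Ioc 0 x ⊆ Icc (0 : ℝ) 1 := fun t ht => ⟨ht.1.le, ht.2.trans hx.2.le⟩
  have hint : IntervalIntegrable (fun t : ℝ => F t / (z * t)) volume 0 x := by
    refine (intervalIntegrable_of_memLp Fact.out (Lp.memLp f) (Ioo_subset_Icc_self hx)).congr_ae ?_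
    rw [uIoc_of_le hx.1.le]
    exact ae_restrict_of_ae_restrict_of_subset hsub hae
  have hd := intervalIntegral.integral_hasDerivAt_right hint
    (hgc.stronglyMeasurableAtFilter isOpen_Ioo x hx) (hgc.continuousAt (Ioo_mem_nhds hx.1 hx.2))
  refine hd.congr_of_eventuallyEq (Filter.eventually_of_mem (Ioo_mem_nhds hx.1 hx.2) ?_)
  intro y hy
  simp only [hF]
  rw [intervalIntegral.integral_of_le hy.1.le, intervalIntegral.integral_of_le hy.1.le]
  refine integral_congr_ae (ae_restrict_of_ae_restrict_of_subset ?_ hae)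
  exact fun t ht => ⟨ht.1.le, ht.2.trans hy.2.le⟩

/-- Solving the differential equation shows that `F x ^ (-z⁻¹)` is a constant `c`. It is nonzero
because `f ≠ 0`, so the power function is the multiple `(z / c) f` of an `L^p` function. -/
theorem memLp_powFun_of_cesaro_eq (hp1 : 1 < p) (hp : p ≠ ∞) {f : Lp ℂ p unitMeasure} (hf : f ≠ 0)
    {z : ℂ}
    (h : cesaro p hp1 hp f = z • f) : MemLp (powFun z⁻¹) p unitMeasure := by
  have hz := eigenvalue_ne_zero hp1 hp hf h
  set F : ℝ → ℂ := fun x => ∫ t in (0 : ℝ)..x, f t with hF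
  have hd : ∀ x ∈ Ioo (0 : ℝ) 1, HasDerivAt (fun x : ℝ => F x * (x : ℂ) ^ (-z⁻¹)) 0 x := by
    intro x hx
    have hx' : (x : ℂ) ≠ 0 := by exact_mod_cast hx.1.ne'
    have := (hasDerivAt_primitive_of_cesaro_eq hp1 hp hz h hx).mul
      (hasDerivAt_ofReal_cpow_const (x := x) hx.1.ne' (neg_ne_zero.2 (inv_ne_zero hz)))
    refine this.congr_deriv ?_
    rw [Complex.cpow_sub _ _ hx', Complex.cpow_one]
    field_simp
    ring
  obtain ⟨c, hc⟩ := isOpen_Ioo.exists_is_const_of_deriv_eq_zero isPreconnected_Ioo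
    (fun x hx => (hd x hx).differentiableAt.differentiableWithinAt)
    (fun x hx => (hd x hx).deriv)
  have hFc : ∀ x ∈ Ioo (0 : ℝ) 1, F x = c * (x : ℂ) ^ z⁻¹ := by
    intro x hx
    have hx' : (x : ℂ) ≠ 0 := by exact_mod_cast hx.1.ne'
    have hne : (x : ℂ) ^ z⁻¹ ≠ 0 := by simp [Complex.cpow_eq_zero_iff, hx']
    rw [← hc x hx, Complex.cpow_neg, inv_mul_cancel_right₀ hne]
  have hc0 : c ≠ 0 := by
    rintro rfl
    exact hf (eq_zero_of_primitive_eq_zero fun x hx => by simpa using hFc x hx)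
  have hm : MemLp (fun x => (z / c) * f x) p unitMeasure := (Lp.memLp f).const_mul _
  refine (memLp_congr_ae ?_).1 hm
  filter_upwards [primitive_ae_eq_of_cesaro_eq hp1 hp h, ae_unitMeasure_mem_Ioo] with x h1 hx
  have hx' : (x : ℂ) ≠ 0 := by exact_mod_cast hx.1.ne'
  have h2 := (hFc x hx).symm.trans h1
  rw [powFun, Complex.cpow_sub _ _ hx', Complex.cpow_one, eq_div_iff hx', div_mul_eq_mul_div,
    div_mul_eq_mul_div, div_eq_iff hc0]
  linear_combination -h2

end

theorem mem_ball_iff_lt_re_inv {q : ℝ} (hq : 0 < q) (z : ℂ) :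
    z ∈ ball ((q / 2 : ℝ) : ℂ) (q / 2) ↔ q⁻¹ < (z⁻¹).re := by
  rw [mem_ball, dist_eq_norm, ← sq_lt_sq₀ (norm_nonneg _) (by positivity), Complex.sq_norm,
    Complex.inv_re]
  rcases eq_or_ne z 0 with rfl | hz
  -- At `z = 0` both sides fail: `0` lies on the boundary circle, and `0⁻¹ = 0` has real part below
  -- `q⁻¹`.
  · simp only [Complex.normSq_apply]
    constructor
    · intro h
      simp at h
      nlinarith
    · intro h
      simp at h
      exact absurd h (not_lt.2 hq.le)
  -- Both sides now say `|z|² < q * z.re`.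
  · rw [lt_div_iff₀ (Complex.normSq_pos.2 hz), inv_mul_lt_iff₀ hq]
    simp only [Complex.normSq_apply, Complex.sub_re, Complex.sub_im, Complex.ofReal_re,
      Complex.ofReal_im]
    constructor <;> intro h <;> nlinarith

/-! ### The point spectrum -/

section

variable {p : ℝ≥0∞} [Fact (1 ≤ p)]

theorem powLp_mem_eigenspace (hp1 : 1 < p) (hp : p ≠ ∞) {q : ℝ}
    (hpq : p.toReal.HolderConjugate q) {w : ℂ} (hw : q⁻¹ < w.re) :
    powLp p w ∈ Module.End.eigenspace (cesaro p hp1 hp : Lp ℂ p unitMeasure →ₗ[ℂ] _) w⁻¹ := by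
  rw [Module.End.mem_eigenspace_iff]
  exact cesaro_powLp hp1 hp ((memLp_powFun_iff hp1 hp hpq w).2 hw)
    ((inv_pos.2 hpq.symm.pos).trans hw)

theorem mem_pointSpectrum_cesaro_iff (hp1 : 1 < p) (hp : p ≠ ∞) {q : ℝ}
    (hpq : p.toReal.HolderConjugate q) (z : ℂ) :
    z ∈ pointSpectrum (cesaro p hp1 hp) ↔ q⁻¹ < (z⁻¹).re := by
  constructor
  · intro h
    obtain ⟨f, hf⟩ := Module.End.HasEigenvalue.exists_hasEigenvector h
    exact (memLp_powFun_iff hp1 hp hpq _).1 (memLp_powFun_of_cesaro_eq hp1 hp hf.2 hf.apply_eq_smul)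
  · intro h
    refine Module.End.hasEigenvalue_of_hasEigenvector (x := powLp p z⁻¹) ⟨?_, ?_⟩
    · simpa using powLp_mem_eigenspace hp1 hp hpq h
    · exact powLp_ne_zero ((memLp_powFun_iff hp1 hp hpq _).2 h)

theorem pointSpectrum_cesaro (hp1 : 1 < p) (hp : p ≠ ∞) {q : ℝ}
    (hpq : p.toReal.HolderConjugate q) :
    pointSpectrum (cesaro p hp1 hp) = ball ((q / 2 : ℝ) : ℂ) (q / 2) := by
  ext z
  rw [mem_pointSpectrum_cesaro_iff hp1 hp hpq, mem_ball_iff_lt_re_inv hpq.symm.pos]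

end

/-! ### Holomorphic dependence on the exponent, and density of polynomials -/

theorem abs_log_le_rpow_neg {x e : ℝ} (hx : x ∈ Ioo (0 : ℝ) 1) (he : 0 < e) :
    |Real.log x| ≤ e⁻¹ * x ^ (-e) := by
  have h := (Real.abs_log_mul_self_rpow_lt x e hx.1 hx.2.le he).le
  have hpos : 0 < x ^ e := Real.rpow_pos_of_pos hx.1 e
  rw [abs_mul, abs_of_pos hpos, ← le_div_iff₀ hpos] at h
  rwa [Real.rpow_neg hx.1.le, ← div_eq_mul_inv, ← one_div]

theorem powFun_add (w h : ℂ) {x : ℝ} (hx : 0 < x) :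
    powFun (w + h) x = powFun w x * Complex.exp (h * Real.log x) := by
  have hx' : (x : ℂ) ≠ 0 := by exact_mod_cast hx.ne'
  rw [powFun, powFun, add_sub_right_comm, Complex.cpow_add _ _ hx', Complex.ofReal_log hx.le,
    mul_comm h, ← Complex.cpow_def_of_ne_zero hx']

theorem norm_log_mul_powFun_le (w : ℂ) {x e : ℝ} (hx : x ∈ Ioo (0 : ℝ) 1) (he : 0 < e) :
    ‖(Real.log x : ℂ) * powFun w x‖ ≤ e⁻¹ * ‖powFun (w - e) x‖ := by
  have h1 : x ^ ((w - e).re - 1) = x ^ (-e) * x ^ (w.re - 1) := by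
    rw [← Real.rpow_add hx.1]
    congr 1
    simp
    ring
  rw [norm_mul, norm_powFun w hx.1, norm_powFun _ hx.1, h1, ← mul_assoc, Complex.norm_real,
    Real.norm_eq_abs]
  have := abs_log_le_rpow_neg hx he
  have := Real.rpow_nonneg hx.1.le (w.re - 1)
  gcongr

/-- The second-order remainder of `exp (h log x)` is at most `|h log x|² exp |h log x|`. Each of the
two logarithms and the exponential costs a factor `x ^ (-e)`, whence the shift by `3 * e`. -/
theorem norm_powFun_taylor_le (w h : ℂ) {x e : ℝ} (hx : x ∈ Ioo (0 : ℝ) 1) (he : 0 < e)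
    (hh : ‖h‖ ≤ e) :
    ‖powFun (w + h) x - powFun w x - h * ((Real.log x : ℂ) * powFun w x)‖ ≤
      (e⁻¹ ^ 2 * ‖h‖ ^ 2) * ‖powFun (w - (3 * e : ℝ)) x‖ := by
  have hlog : |Real.log x| = - Real.log x := abs_of_neg (Real.log_neg hx.1 hx.2)
  have h1 : x ^ ((w - (3 * e : ℝ)).re - 1) =
      (x ^ (-e)) ^ 2 * x ^ (-e) * x ^ (w.re - 1) := by
    rw [← Real.rpow_natCast, ← Real.rpow_mul hx.1.le, ← Real.rpow_add hx.1, ← Real.rpow_add hx.1]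
    congr 1
    simp
    ring
  have h2 := Complex.norm_exp_sub_sum_le_norm_mul_exp (h * Real.log x) 2
  simp only [Finset.sum_range_succ, Finset.sum_range_zero, pow_zero, pow_one, Nat.factorial,
    zero_add, Nat.cast_one, div_one, Nat.succ_eq_add_one, mul_one] at h2
  have h3 : ‖h * Real.log x‖ = ‖h‖ * |Real.log x| := by
    rw [norm_mul, Complex.norm_real, Real.norm_eq_abs]
  have h4 : Real.exp (‖h‖ * |Real.log x|) ≤ x ^ (-e) := by
    rw [Real.rpow_def_of_pos hx.1]
    refine Real.exp_le_exp.2 ?_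
    calc ‖h‖ * |Real.log x| ≤ e * |Real.log x| := by gcongr
      _ = _ := by rw [hlog]; ring
  have h5 := abs_log_le_rpow_neg hx he
  have h6 : powFun (w + h) x - powFun w x - h * ((Real.log x : ℂ) * powFun w x) =
      powFun w x * (Complex.exp (h * Real.log x) - (1 + h * Real.log x)) := by
    rw [powFun_add w h hx.1]
    ring
  rw [h6, norm_mul, norm_powFun w hx.1, norm_powFun _ hx.1, h1]
  rw [h3] at h2
  have hxe := Real.rpow_nonneg hx.1.le (-e)
  calc _ ≤ x ^ (w.re - 1) * ((‖h‖ * |Real.log x|) ^ 2 * Real.exp (‖h‖ * |Real.log x|)) := by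
        have := Real.rpow_nonneg hx.1.le (w.re - 1)
        gcongr
    _ ≤ x ^ (w.re - 1) * ((‖h‖ * (e⁻¹ * x ^ (-e))) ^ 2 * x ^ (-e)) := by
        have := Real.rpow_nonneg hx.1.le (w.re - 1)
        gcongr
    _ = _ := by ring

theorem exists_polynomial_ae_eq {p : ℝ≥0∞} (hp1 : 1 < p) (hp : p ≠ ∞) {q : ℝ}
    (hpq : p.toReal.HolderConjugate q) {M : Submodule ℂ (Lp ℂ p unitMeasure)}
    (hM : ∀ n : ℕ, powLp p (n + 1) ∈ M) (P : Polynomial ℂ) :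
    ∃ f ∈ M, f =ᵐ[unitMeasure] fun x : ℝ => P.eval (x : ℂ) := by
  have hq : q⁻¹ < 1 := by
    have := hpq.inv_add_inv_eq_one
    have := inv_pos.2 hpq.pos
    linarith
  induction P using Polynomial.induction_on' with
  | add P Q hP hQ =>
    obtain ⟨f, hf, hfP⟩ := hP
    obtain ⟨g, hg, hgQ⟩ := hQ
    refine ⟨f + g, M.add_mem hf hg, ?_⟩
    filter_upwards [Lp.coeFn_add f g, hfP, hgQ] with x h1 h2 h3
    rw [h1, Pi.add_apply, h2, h3, Polynomial.eval_add]
  | monomial n a =>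
    -- The parameter `n + 1` gives the monomial `x ^ n`.
    refine ⟨a • powLp p (n + 1), M.smul_mem a (hM n), ?_⟩
    have hn : MemLp (powFun (n + 1)) p unitMeasure := by
      refine (memLp_powFun_iff hp1 hp hpq _).2 ?_
      simp only [Complex.add_re, Complex.natCast_re, Complex.one_re]
      have : (0 : ℝ) ≤ n := n.cast_nonneg
      linarith
    filter_upwards [Lp.coeFn_smul a (powLp p (n + 1)), coeFn_powLp hn] with x h1 h2
    rw [h1, Pi.smul_apply, h2, powFun, add_sub_cancel_right, Complex.cpow_natCast,
      Polynomial.eval_monomial, smul_eq_mul]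

section

variable {p : ℝ≥0∞} [Fact (1 ≤ p)]

/-- The derivative is `log x * x ^ (w - 1)`. Since the half-plane is open, the small powers lost to
the logarithms keep every majorant in `L^p`, and the pointwise Taylor bound becomes an `O(‖h‖²)`
bound in norm. -/
theorem differentiableAt_powLp (hp1 : 1 < p) (hp : p ≠ ∞) {q : ℝ}
    (hpq : p.toReal.HolderConjugate q) {w : ℂ} (hw : q⁻¹ < w.re) :
    DifferentiableAt ℂ (powLp p) w := by
  obtain ⟨e, he, hwe⟩ : ∃ e : ℝ, 0 < e ∧ q⁻¹ < w.re - 3 * e :=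
    -- This puts `w.re - 3 * e` midway between `q⁻¹` and `w.re`.
    ⟨(w.re - q⁻¹) / 6, by linarith, by linarith⟩
  have hmem : ∀ v : ℂ, q⁻¹ < v.re → MemLp (powFun v) p unitMeasure := fun v hv =>
    (memLp_powFun_iff hp1 hp hpq v).2 hv
  have hD : MemLp (fun x : ℝ => (Real.log x : ℂ) * powFun w x) p unitMeasure := by
    refine (hmem (w - e) (by simp; linarith)).of_le_mul (c := e⁻¹) ?_ ?_
    · have h1 := measurable_powFun w
      exact Measurable.aestronglyMeasurable (by fun_prop)
    · filter_upwards [ae_unitMeasure_mem_Ioo] with x hx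
      exact norm_log_mul_powFun_le w hx he
  have hg := hmem (w - (3 * e : ℝ)) (by simpa using hwe)
  refine HasDerivAt.differentiableAt (f' := hD.toLp _) ?_
  rw [hasDerivAt_iff_isLittleO_nhds_zero]
  refine (Asymptotics.IsBigO.of_bound (e⁻¹ ^ 2 * ‖powLp p (w - (3 * e : ℝ))‖)
    ?_).trans_isLittleO (Asymptotics.isLittleO_pow_id (one_lt_two))
  filter_upwards [Metric.ball_mem_nhds (0 : ℂ) he] with h hh
  rw [mem_ball_zero_iff] at hh
  have hre : -e < h.re := by
    have := (abs_le.1 (Complex.abs_re_le_norm h)).1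
    linarith
  rw [norm_pow, mul_right_comm]
  refine Lp.norm_le_mul_norm_of_ae_le_mul ?_
  filter_upwards [Lp.coeFn_sub (powLp p (w + h) - powLp p w) (h • hD.toLp _),
    Lp.coeFn_sub (powLp p (w + h)) (powLp p w), Lp.coeFn_smul h (hD.toLp _), hD.coeFn_toLp,
    coeFn_powLp hg, coeFn_powLp (hmem w (by linarith)),
    coeFn_powLp (hmem (w + h) (by simp; linarith)), ae_unitMeasure_mem_Ioo]
    with x h1 h2 h3 h4 h5 h6 h7 hx
  rw [h1, Pi.sub_apply, h2, Pi.sub_apply, h3, Pi.smul_apply, h4, h5, h6, h7, smul_eq_mul]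
  exact norm_powFun_taylor_le w h hx he hh.le

/-- Bounded continuous functions are dense in `L^p`, and Weierstrass approximation on `[0, 1]`
applies to their real and imaginary parts. -/
theorem eq_top_of_forall_powLp_natCast_mem (hp1 : 1 < p) (hp : p ≠ ∞) {q : ℝ}
    (hpq : p.toReal.HolderConjugate q) {M : Submodule ℂ (Lp ℂ p unitMeasure)}
    (hcl : IsClosed (M : Set (Lp ℂ p unitMeasure))) (hM : ∀ n : ℕ, powLp p (n + 1) ∈ M) :
    M = ⊤ := by
  have h1 : MemLp (powFun 1) p unitMeasure := by
    refine (memLp_powFun_iff hp1 hp hpq _).2 ?_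
    have := hpq.inv_add_inv_eq_one
    have := inv_pos.2 hpq.pos
    simp only [Complex.one_re]
    linarith
  suffices h : ∀ g : BoundedContinuousFunction ℝ ℂ,
      BoundedContinuousFunction.toLp p unitMeasure ℂ g ∈ M by
    rw [← SetLike.coe_set_eq, Submodule.top_coe, ← hcl.closure_eq]
    refine Dense.closure_eq ?_
    refine (BoundedContinuousFunction.toLp_denseRange ℂ unitMeasure ℂ hp).mono ?_
    rintro _ ⟨g, rfl⟩
    exact h g
  intro g
  rw [← SetLike.mem_coe, ← hcl.closure_eq, Metric.mem_closure_iff]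
  intro e he
  -- `powLp p 1` is the constant function `1`; its norm converts uniform bounds into norm bounds.
  -- Two errors of `e / (4 * C)` add up to `e / 2` in norm.
  set C := ‖powLp p 1‖
  have hC : 0 < C := norm_pos_iff.2 (powLp_ne_zero h1)
  obtain ⟨P, hP⟩ := exists_polynomial_near_of_continuousOn 0 1 (fun x => (g x).re)
    (Continuous.continuousOn (by fun_prop)) (e / (4 * C)) (by positivity)
  obtain ⟨Q, hQ⟩ := exists_polynomial_near_of_continuousOn 0 1 (fun x => (g x).im)
    (Continuous.continuousOn (by fun_prop)) (e / (4 * C)) (by positivity)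
  obtain ⟨f, hf, hfae⟩ := exists_polynomial_ae_eq hp1 hp hpq hM
    (P.map Complex.ofRealHom + Polynomial.C Complex.I * Q.map Complex.ofRealHom)
  refine ⟨f, hf, ?_⟩
  rw [dist_eq_norm]
  have : ‖BoundedContinuousFunction.toLp p unitMeasure ℂ g - f‖ ≤ (e / (2 * C)) * C := by
    refine Lp.norm_le_mul_norm_of_ae_le_mul ?_
    filter_upwards [Lp.coeFn_sub (BoundedContinuousFunction.toLp p unitMeasure ℂ g) f, hfae,
      BoundedContinuousFunction.coeFn_toLp (𝕜 := ℂ) p unitMeasure g, coeFn_powLp h1,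
      ae_unitMeasure_mem_Ioo] with x e1 e2 e3 e4 hx
    have hev : ∀ R : Polynomial ℝ, (R.map Complex.ofRealHom).eval (x : ℂ) = (R.eval x : ℝ) :=
      fun R => by
        rw [Polynomial.eval_map, ← Complex.ofRealHom_eq_coe x, Polynomial.eval₂_at_apply]
        rfl
    rw [e1, Pi.sub_apply, e2, e3, e4, norm_powFun 1 hx.1, Polynomial.eval_add,
      Polynomial.eval_mul, Polynomial.eval_C, hev, hev]
    simp only [Complex.one_re, sub_self, Real.rpow_zero, mul_one]
    have hxI := Ioo_subset_Icc_self hx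
    refine (Complex.norm_le_abs_re_add_abs_im _).trans ?_
    have hP' := hP x hxI
    have hQ' := hQ x hxI
    rw [abs_sub_comm] at hP' hQ'
    have : e / (2 * C) = e / (4 * C) + e / (4 * C) := by ring
    simp
    linarith
  have h2 : e / (2 * C) * C = e / 2 := by field_simp
  linarith

/-! ### Rich point spectrum -/

theorem dense_span_eigenspaces (hp1 : 1 < p) (hp : p ≠ ∞) {q : ℝ}
    (hpq : p.toReal.HolderConjugate q) {c : ℂ} {r : ℝ} (hr : 0 < r)
    (hc : ball c r ⊆ pointSpectrum (cesaro p hp1 hp)) :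
    Dense (Submodule.span ℂ (⋃ z ∈ ball c r, (Module.End.eigenspace
      (cesaro p hp1 hp : Lp ℂ p unitMeasure →ₗ[ℂ] _) z : Set (Lp ℂ p unitMeasure))) :
        Set (Lp ℂ p unitMeasure)) := by
  set S := Submodule.span ℂ (⋃ z ∈ ball c r, (Module.End.eigenspace
      (cesaro p hp1 hp : Lp ℂ p unitMeasure →ₗ[ℂ] _) z : Set (Lp ℂ p unitMeasure)))
  set M := S.topologicalClosure
  have hcl : IsClosed (M : Set (Lp ℂ p unitMeasure)) := S.isClosed_topologicalClosure
  set U : Set ℂ := {w | q⁻¹ < w.re} with hU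
  have hUo : IsOpen U := isOpen_lt continuous_const Complex.continuous_re
  have hcU : c⁻¹ ∈ U := (mem_pointSpectrum_cesaro_iff hp1 hp hpq c).1 (hc (mem_ball_self hr))
  have hc0 : c⁻¹ ≠ 0 := by
    intro h0
    have : q⁻¹ < (c⁻¹).re := hcU
    rw [h0, Complex.zero_re] at this
    exact absurd this (not_lt.2 (inv_pos.2 hpq.symm.pos).le)
  -- In the quotient by the closed subspace `M`, membership in `M` becomes vanishing of a
  -- holomorphic function, to which the identity theorem applies.
  have han : AnalyticOnNhd ℂ (fun w => M.mkQL (powLp p w)) U := by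
    refine DifferentiableOn.analyticOnNhd (fun w hw => ?_) hUo
    exact ((M.mkQL.differentiableAt).comp w
      (differentiableAt_powLp hp1 hp hpq hw)).differentiableWithinAt
  have hev : (fun w => M.mkQL (powLp p w)) =ᶠ[nhds c⁻¹] 0 := by
    have h1 : ∀ᶠ w in nhds c⁻¹, w⁻¹ ∈ ball c r := by
      have h2 : Filter.Tendsto (fun w : ℂ => w⁻¹) (nhds c⁻¹) (nhds (c⁻¹)⁻¹) :=
        (continuousAt_inv₀ hc0)
      rw [inv_inv] at h2
      exact h2.eventually (ball_mem_nhds c hr)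
    filter_upwards [h1, hUo.mem_nhds hcU] with w hw hwU
    change Submodule.Quotient.mk (powLp p w) = 0
    rw [Submodule.Quotient.mk_eq_zero]
    refine S.le_topologicalClosure (Submodule.subset_span ?_)
    exact mem_biUnion hw (powLp_mem_eigenspace hp1 hp hpq hwU)
  have hzero := han.eqOn_zero_of_preconnected_of_eventuallyEq_zero
    (convex_halfSpace_re_gt _).isPreconnected hcU hev
  rw [Submodule.dense_iff_topologicalClosure_eq_top]
  refine eq_top_of_forall_powLp_natCast_mem hp1 hp hpq hcl fun n => ?_
  rw [← Submodule.Quotient.mk_eq_zero]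
  refine hzero ?_
  have := hpq.inv_add_inv_eq_one
  have := inv_pos.2 hpq.pos
  have : (0 : ℝ) ≤ n := n.cast_nonneg
  simp only [hU, mem_ofPred_eq, Complex.add_re, Complex.natCast_re, Complex.one_re]
  linarith

theorem hasRichPointSpectrum_cesaro (hp1 : 1 < p) (hp : p ≠ ∞) :
    HasRichPointSpectrum (cesaro p hp1 hp) := by
  have hpq := Real.HolderConjugate.conjExponent (p := p.toReal) (by
    rw [← ENNReal.toReal_one]; exact (ENNReal.toReal_lt_toReal ENNReal.one_ne_top hp).2 hp1)
  refine ⟨?_, fun c r hr hc => dense_span_eigenspaces hp1 hp hpq hr hc⟩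
  rw [pointSpectrum_cesaro hp1 hp hpq, isOpen_ball.interior_eq]
  exact nonempty_ball.2 (half_pos hpq.symm.pos)

end

/-! ### The weighted substitution operator -/

theorem image_rpow_Ioo {a : ℝ} (ha : 0 < a) :
    (fun x : ℝ => x ^ a) '' Ioo 0 1 = Ioo (0 : ℝ) 1 := by
  ext y
  constructor
  · rintro ⟨x, hx, rfl⟩
    exact ⟨Real.rpow_pos_of_pos hx.1 a, Real.rpow_lt_one hx.1.le hx.2 ha⟩
  · intro hy
    refine ⟨y ^ a⁻¹, ⟨Real.rpow_pos_of_pos hy.1 _, Real.rpow_lt_one hy.1.le hy.2 (inv_pos.2 ha)⟩,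
      ?_⟩
    exact Real.rpow_inv_rpow hy.1.le ha.ne'

theorem lintegral_unitMeasure_comp_rpow {a : ℝ} (ha : 0 < a) (g : ℝ → ℝ≥0∞) :
    ∫⁻ x, g x ∂unitMeasure =
      ∫⁻ x, ENNReal.ofReal (a * x ^ (a - 1)) * g (x ^ a) ∂unitMeasure := by
  rw [unitMeasure, ← restrict_Ioo_eq_restrict_Icc]
  have h := lintegral_image_eq_lintegral_abs_deriv_mul (s := Ioo (0 : ℝ) 1)
    (f := fun x => x ^ a) (f' := fun x => a * x ^ (a - 1)) measurableSet_Ioo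
    (fun x hx => (Real.hasDerivAt_rpow_const (Or.inl hx.1.ne')).hasDerivWithinAt)
    (fun x hx y hy hxy => (Real.rpow_left_inj hx.1.le hy.1.le ha.ne').1 hxy) g
  rw [image_rpow_Ioo ha] at h
  rw [h]
  refine setLIntegral_congr_fun measurableSet_Ioo fun x hx => ?_
  have := Real.rpow_nonneg hx.1.le (a - 1)
  rw [abs_of_nonneg (by positivity)]

/-- Needed for the substitution to respect almost-everywhere classes. The change of variables,
tested on the indicator of a null set, has the positive density `a * x ^ (a - 1)`, so the preimage
is null. -/
theorem quasiMeasurePreserving_rpow {a : ℝ} (ha : 0 < a) :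
    Measure.QuasiMeasurePreserving (fun x : ℝ => x ^ a) unitMeasure unitMeasure := by
  have hm : Measurable fun x : ℝ => x ^ a := by fun_prop
  refine ⟨hm, Measure.AbsolutelyContinuous.mk fun s hs h0 => ?_⟩
  rw [Measure.map_apply hm hs]
  have h := lintegral_unitMeasure_comp_rpow ha (s.indicator 1)
  rw [lintegral_indicator_one hs, h0, eq_comm, lintegral_eq_zero_iff (by
    have : Measurable (s.indicator (1 : ℝ → ℝ≥0∞)) := measurable_one.indicator hs
    fun_prop)] at h
  refine measure_mono_null ?_ (measure_union_null h (ae_unitMeasure_mem_Ioo))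
  intro x hx
  by_contra hcon
  simp only [mem_union, mem_compl_iff, not_or, not_not] at hcon
  have hxI : x ∈ Ioo (0 : ℝ) 1 := hcon.2
  have h1 : ENNReal.ofReal (a * x ^ (a - 1)) * s.indicator 1 (x ^ a) = 0 := hcon.1
  have h2 : s.indicator (1 : ℝ → ℝ≥0∞) (x ^ a) = 1 := indicator_of_mem (mem_preimage.1 hx) _
  rw [h2, mul_one, ENNReal.ofReal_eq_zero] at h1
  have := Real.rpow_pos_of_pos hxI.1 (a - 1)
  exact absurd h1 (not_le.2 (by positivity))

/-- The weighted substitution `f ↦ x ^ (a - 1) f (x ^ a)`. -/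
noncomputable def weightedSubst (a : ℝ) (f : ℝ → ℂ) (x : ℝ) : ℂ :=
  ((x ^ (a - 1) : ℝ) : ℂ) * f (x ^ a)

theorem weightedSubst_congr {a : ℝ} (ha : 0 < a) {f g : ℝ → ℂ} (h : f =ᵐ[unitMeasure] g) :
    weightedSubst a f =ᵐ[unitMeasure] weightedSubst a g := by
  filter_upwards [(quasiMeasurePreserving_rpow ha).ae_eq_comp h] with x hx
  have hx' : f (x ^ a) = g (x ^ a) := hx
  rw [weightedSubst, weightedSubst, hx']

/-- After the change of variables it is enough to compare weights: `x ^ (a - 1) ≤ 1` gives `(x ^ (a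
- 1)) ^ p ≤ x ^ (a - 1) ≤ a * x ^ (a - 1)`. -/
theorem eLpNorm_weightedSubst_le {p : ℝ≥0∞} (hp1 : 1 ≤ p) (hp : p ≠ ∞) {a : ℝ} (ha : 1 ≤ a)
    (f : ℝ → ℂ) :
    eLpNorm (weightedSubst a f) p unitMeasure ≤ eLpNorm f p unitMeasure := by
  have hr1 : 1 ≤ p.toReal := by
    rw [← ENNReal.toReal_one]; exact (ENNReal.toReal_le_toReal ENNReal.one_ne_top hp).2 hp1
  have hr0 : 0 < p.toReal := by linarith
  have ha0 : 0 < a := by linarith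
  have hp0 : p ≠ 0 := (zero_lt_one.trans_le hp1).ne'
  rw [eLpNorm_eq_lintegral_rpow_enorm_toReal hp0 hp, eLpNorm_eq_lintegral_rpow_enorm_toReal hp0 hp]
  refine ENNReal.rpow_le_rpow ?_ (by positivity)
  rw [lintegral_unitMeasure_comp_rpow ha0 fun x => ‖f x‖ₑ ^ p.toReal]
  refine lintegral_mono_ae ?_
  filter_upwards [ae_unitMeasure_mem_Ioo] with x hx
  have h0 : 0 ≤ x ^ (a - 1) := Real.rpow_nonneg hx.1.le _
  have h1 : x ^ (a - 1) ≤ 1 := Real.rpow_le_one hx.1.le hx.2.le (by linarith)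
  rw [weightedSubst, enorm_mul, ENNReal.mul_rpow_of_nonneg _ _ hr0.le]
  gcongr
  rw [← ofReal_norm, Complex.norm_real, Real.norm_of_nonneg h0,
    ENNReal.ofReal_rpow_of_nonneg h0 hr0.le]
  refine ENNReal.ofReal_le_ofReal ?_
  calc (x ^ (a - 1)) ^ p.toReal ≤ (x ^ (a - 1)) ^ (1 : ℝ) :=
        Real.rpow_le_rpow_of_exponent_ge' h0 h1 zero_le_one hr1
    _ = 1 * x ^ (a - 1) := by rw [Real.rpow_one, one_mul]
    _ ≤ a * x ^ (a - 1) := by gcongr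

theorem memLp_weightedSubst {p : ℝ≥0∞} (hp1 : 1 ≤ p) (hp : p ≠ ∞) {a : ℝ} (ha : 1 ≤ a)
    {f : ℝ → ℂ} (hf : MemLp f p unitMeasure) : MemLp (weightedSubst a f) p unitMeasure := by
  refine ⟨?_, (eLpNorm_weightedSubst_le hp1 hp ha f).trans_lt hf.2⟩
  have h1 : Measurable fun x : ℝ => ((x ^ (a - 1) : ℝ) : ℂ) := by fun_prop
  exact h1.aestronglyMeasurable.mul
    (hf.1.comp_quasiMeasurePreserving (quasiMeasurePreserving_rpow (by linarith)))

theorem weightedSubst_powFun (a : ℝ) (w : ℂ) {x : ℝ} (hx : 0 < x) :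
    weightedSubst a (powFun w) x = powFun (a * w) x := by
  have hx' : (x : ℂ) ≠ 0 := by exact_mod_cast hx.ne'
  have h1 : ((x ^ a : ℝ) : ℂ) ^ (w - 1) = (x : ℂ) ^ ((a : ℂ) * (w - 1)) := by
    have h2 : ((x ^ a : ℝ) : ℂ) ≠ 0 := by exact_mod_cast (Real.rpow_pos_of_pos hx a).ne'
    rw [Complex.cpow_def_of_ne_zero h2, Complex.cpow_def_of_ne_zero hx',
      ← Complex.ofReal_log (Real.rpow_pos_of_pos hx a).le, ← Complex.ofReal_log hx.le,
      Real.log_rpow hx]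
    push_cast
    ring_nf
  rw [weightedSubst, powFun, powFun, h1, Complex.ofReal_cpow hx.le, ← Complex.cpow_add _ _ hx']
  congr 1
  push_cast
  ring

/-- The weighted substitution `f ↦ x ^ (a - 1) f (x ^ a)`, `1 ≤ a`, as a bounded linear operator
on `L^p[0, 1]`. -/
noncomputable def weightedSubstLp (p : ℝ≥0∞) [Fact (1 ≤ p)] (hp : p ≠ ∞) {a : ℝ} (ha : 1 ≤ a) :
    Lp ℂ p unitMeasure →L[ℂ] Lp ℂ p unitMeasure :=
  LinearMap.mkContinuous
    { toFun := fun f => (memLp_weightedSubst Fact.out hp ha (Lp.memLp f)).toLp _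
      map_add' := fun f g => by
        rw [← MemLp.toLp_add, MemLp.toLp_eq_toLp_iff]
        filter_upwards [weightedSubst_congr (by linarith) (Lp.coeFn_add f g)] with x hx
        rw [hx, Pi.add_apply]
        simp only [weightedSubst, Pi.add_apply, mul_add]
      map_smul' := fun c f => by
        rw [RingHom.id_apply, ← MemLp.toLp_const_smul, MemLp.toLp_eq_toLp_iff]
        filter_upwards [weightedSubst_congr (by linarith) (Lp.coeFn_smul c f)] with x hx
        rw [hx, Pi.smul_apply]
        simp only [weightedSubst, Pi.smul_apply, smul_eq_mul, mul_left_comm] }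
    1 fun f => by
      rw [one_mul, LinearMap.coe_mk, AddHom.coe_mk, Lp.norm_toLp, Lp.norm_def f]
      exact ENNReal.toReal_mono (Lp.memLp f).2.ne (eLpNorm_weightedSubst_le Fact.out hp ha f)

theorem weightedSubstLp_apply_ae {p : ℝ≥0∞} [Fact (1 ≤ p)] (hp : p ≠ ∞) {a : ℝ} (ha : 1 ≤ a)
    (f : Lp ℂ p unitMeasure) :
    weightedSubstLp p hp ha f =ᵐ[unitMeasure] weightedSubst a f :=
  (memLp_weightedSubst Fact.out hp ha (Lp.memLp f)).coeFn_toLp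

/-! ### Extended eigenvalues -/

section

variable {p : ℝ≥0∞} [Fact (1 ≤ p)]

theorem weightedSubstLp_powLp (hp : p ≠ ∞) {a : ℝ} (ha : 1 ≤ a) {w : ℂ}
    (hw : MemLp (powFun w) p unitMeasure) (haw : MemLp (powFun (a * w)) p unitMeasure) :
    weightedSubstLp p hp ha (powLp p w) = powLp p (a * w) := by
  refine Lp.ext ?_
  filter_upwards [weightedSubstLp_apply_ae hp ha (powLp p w), coeFn_powLp haw,
    weightedSubst_congr (a := a) (by linarith) (coeFn_powLp hw), ae_unitMeasure_mem_Ioo]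
    with x h1 h2 h3 hx
  rw [h1, h2, h3, weightedSubst_powFun a w hx.1]

/-- On the function of parameter `w`, `T X` produces the factor `(a w)⁻¹` and `X T` the factor
`w⁻¹`. The intertwining relation thus holds on monomials, and extends because the kernel of the
difference is closed. -/
theorem isExtendedEigenvalue_cesaro_inv (hp1 : 1 < p) (hp : p ≠ ∞) {a : ℝ} (ha : 1 ≤ a) :
    IsExtendedEigenvalue (cesaro p hp1 hp) ((a⁻¹ : ℝ) : ℂ) := by
  have hpq := Real.HolderConjugate.conjExponent (p := p.toReal) (by
    rw [← ENNReal.toReal_one]; exact (ENNReal.toReal_lt_toReal ENNReal.one_ne_top hp).2 hp1)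
  set q := p.toReal.conjExponent
  have hsum := hpq.inv_add_inv_eq_one
  have hpinv := inv_pos.2 hpq.pos
  have hqinv := inv_pos.2 hpq.symm.pos
  have hn : ∀ n : ℕ, q⁻¹ < ((n : ℂ) + 1).re := fun n => by
    have : (0 : ℝ) ≤ n := n.cast_nonneg
    simp only [Complex.add_re, Complex.natCast_re, Complex.one_re]
    linarith
  have han : ∀ n : ℕ, q⁻¹ < ((a : ℂ) * ((n : ℂ) + 1)).re := fun n => by
    rw [Complex.re_ofReal_mul]
    nlinarith [hn n]
  have hmem := memLp_powFun_iff hp1 hp hpq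
  have hX : ∀ n : ℕ, weightedSubstLp p hp ha (powLp p (n + 1)) = powLp p (a * (n + 1)) := fun n =>
    weightedSubstLp_powLp hp ha ((hmem _).2 (hn n)) ((hmem _).2 (han n))
  refine ⟨weightedSubstLp p hp ha, fun h0 => ?_, ?_⟩
  -- `X` sends the constant `1` to `x ^ (a - 1)`, which is nonzero.
  · have h1 := hX 0
    rw [h0] at h1
    exact powLp_ne_zero ((hmem _).2 (han 0)) h1.symm
  · set D := cesaro p hp1 hp ∘L weightedSubstLp p hp ha -
      ((a⁻¹ : ℝ) : ℂ) • (weightedSubstLp p hp ha ∘L cesaro p hp1 hp) with hD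
    have htop : LinearMap.ker (D : Lp ℂ p unitMeasure →ₗ[ℂ] Lp ℂ p unitMeasure) = ⊤ := by
      refine eq_top_of_forall_powLp_natCast_mem hp1 hp hpq D.isClosed_ker fun n => ?_
      rw [LinearMap.mem_ker]
      have e1 := cesaro_powLp hp1 hp ((hmem _).2 (hn n)) (hqinv.trans (hn n))
      have e2 := cesaro_powLp hp1 hp ((hmem _).2 (han n)) (hqinv.trans (han n))
      change cesaro p hp1 hp (weightedSubstLp p hp ha (powLp p (n + 1))) -
        ((a⁻¹ : ℝ) : ℂ) • weightedSubstLp p hp ha (cesaro p hp1 hp (powLp p (n + 1))) = 0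
      rw [e1, map_smul, hX, e2, smul_smul, mul_inv, Complex.ofReal_inv, sub_self]
    rw [← sub_eq_zero, ← hD]
    ext1 f
    have : f ∈ LinearMap.ker (D : Lp ℂ p unitMeasure →ₗ[ℂ] Lp ℂ p unitMeasure) := by
      rw [htop]; trivial
    exact this

theorem le_re_inv_mul_of_isExtendedEigenvalue (hp1 : 1 < p) (hp : p ≠ ∞) {q : ℝ}
    (hpq : p.toReal.HolderConjugate q) {lam : ℂ}
    (h : IsExtendedEigenvalue (cesaro p hp1 hp) lam) {w : ℂ} (hw : q⁻¹ < w.re) :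
    q⁻¹ ≤ (lam⁻¹ * w).re := by
  obtain ⟨X, hX0, hX⟩ := h
  by_contra! hlt
  have hw0 : w ≠ 0 := by
    rintro rfl
    exact absurd hw (not_lt.2 (by simpa using hpq.symm.pos.le))
  -- The failure at `w` is an open condition, so it persists on a whole disc of eigenvalues, whose
  -- eigenspaces are total.
  have hev : ∀ᶠ z in nhds w⁻¹, q⁻¹ < (z⁻¹).re ∧ (lam⁻¹ * z⁻¹).re < q⁻¹ := by
    have h2 : Filter.Tendsto (fun z : ℂ => z⁻¹) (nhds w⁻¹) (nhds (w⁻¹)⁻¹) :=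
      continuousAt_inv₀ (inv_ne_zero hw0)
    rw [inv_inv] at h2
    have ho : IsOpen {v : ℂ | q⁻¹ < v.re ∧ (lam⁻¹ * v).re < q⁻¹} :=
      by
      have h3 : IsOpen {v : ℂ | q⁻¹ < v.re} := isOpen_lt continuous_const (by fun_prop)
      have h4 : IsOpen {v : ℂ | (lam⁻¹ * v).re < q⁻¹} := isOpen_lt (by fun_prop) continuous_const
      exact h3.inter h4
    exact h2.eventually (ho.mem_nhds ⟨hw, hlt⟩)
  obtain ⟨r, hr, hball⟩ := Metric.eventually_nhds_iff_ball.1 hev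
  have hps : ball w⁻¹ r ⊆ pointSpectrum (cesaro p hp1 hp) := fun z hz =>
    (mem_pointSpectrum_cesaro_iff hp1 hp hpq z).2 (hball z hz).1
  have hdense := dense_span_eigenspaces hp1 hp hpq hr hps
  refine hX0 (ContinuousLinearMap.ext_on hdense ?_)
  intro g hg
  obtain ⟨z, hz, hgz⟩ := mem_iUnion₂.1 hg
  have hTg : cesaro p hp1 hp g = z • g := Module.End.mem_eigenspace_iff.1 hgz
  have hTX : cesaro p hp1 hp (X g) = (lam * z) • X g := by
    have := congrArg (fun Y : Lp ℂ p unitMeasure →L[ℂ] Lp ℂ p unitMeasure => Y g) hX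
    simp only [ContinuousLinearMap.comp_apply, smul_apply] at this
    rw [this, hTg, map_smul, smul_smul]
  by_contra hne
  -- A nonzero `X g` would make `lam * z` an eigenvalue. The case `lam = 0` is included through `0⁻¹
  -- = 0`.
  have h1 := (memLp_powFun_iff hp1 hp hpq _).1 (memLp_powFun_of_cesaro_eq hp1 hp hne hTX)
  rw [mul_inv] at h1
  exact lt_asymm h1 (hball z hz).2

theorem exists_one_le_eq_of_forall_le_re_mul {m : ℂ} {k : ℝ} (hk : 0 < k)
    (h : ∀ w : ℂ, k < w.re → k ≤ (m * w).re) : ∃ a : ℝ, 1 ≤ a ∧ m = a := by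
  have h' : ∀ s t : ℝ, k < s → k ≤ m.re * s - m.im * t := fun s t hs => by
    simpa using h ⟨s, t⟩ hs
  have him : m.im = 0 := by
    by_contra hne
    -- This `t` makes the real part of the product zero, below `k`.
    have := h' (2 * k) (m.re * (2 * k) / m.im) (by linarith)
    rw [mul_div_cancel₀ _ hne] at this
    linarith
  refine ⟨m.re, ?_, Complex.ext rfl (by simpa using him)⟩
  by_contra! hlt
  -- This point exceeds `k` when `m.re < 1`, yet its image is `k * (1 - (1 - m.re)²) < k`.
  have := h' (k * (2 - m.re)) 0 (by nlinarith)
  nlinarith [mul_pos hk (pow_pos (sub_pos.2 hlt) 2)]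

theorem isExtendedEigenvalue_cesaro_iff (hp1 : 1 < p) (hp : p ≠ ∞) (lam : ℂ) :
    IsExtendedEigenvalue (cesaro p hp1 hp) lam ↔ ∃ s : ℝ, 0 < s ∧ s ≤ 1 ∧ lam = (s : ℂ) := by
  have hpq := Real.HolderConjugate.conjExponent (p := p.toReal) (by
    rw [← ENNReal.toReal_one]; exact (ENNReal.toReal_lt_toReal ENNReal.one_ne_top hp).2 hp1)
  constructor
  · intro h
    obtain ⟨a, ha, hla⟩ := exists_one_le_eq_of_forall_le_re_mul (inv_pos.2 hpq.symm.pos)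
      fun w hw => le_re_inv_mul_of_isExtendedEigenvalue hp1 hp hpq h hw
    refine ⟨a⁻¹, by positivity, inv_le_one_of_one_le₀ ha, ?_⟩
    rw [Complex.ofReal_inv, ← hla, inv_inv]
  · rintro ⟨s, hs0, hs1, rfl⟩
    simpa using isExtendedEigenvalue_cesaro_inv hp1 hp ((one_le_inv₀ hs0).2 hs1)

end

end ExtendedEigenvalues

theorem mainTheorem2 (p : ℝ≥0∞) [Fact (1 ≤ p)] (hp1 : 1 < p) (hp : p ≠ ∞)
    (q : ℝ) (hpq : p.toReal.HolderConjugate q) :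
    ExtendedEigenvalues.pointSpectrum (ExtendedEigenvalues.cesaro p hp1 hp) =
        ball ((q / 2 : ℝ) : ℂ) (q / 2) ∧
      ExtendedEigenvalues.HasRichPointSpectrum (ExtendedEigenvalues.cesaro p hp1 hp) ∧
      (∀ lam : ℂ, ExtendedEigenvalues.IsExtendedEigenvalue
        (ExtendedEigenvalues.cesaro p hp1 hp) lam → ∃ s : ℝ, 0 < s ∧ s ≤ 1 ∧ lam = (s : ℂ)) ∧
      {lam : ℂ | ExtendedEigenvalues.IsExtendedEigenvalue
        (ExtendedEigenvalues.cesaro p hp1 hp) lam} = (fun s : ℝ => (s : ℂ)) '' Ioc (0 : ℝ) 1 := by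
  refine ⟨ExtendedEigenvalues.pointSpectrum_cesaro hp1 hp hpq,
    ExtendedEigenvalues.hasRichPointSpectrum_cesaro hp1 hp,
    fun lam h => (ExtendedEigenvalues.isExtendedEigenvalue_cesaro_iff hp1 hp lam).1 h, ?_⟩
  ext lam
  rw [mem_ofPred_eq, ExtendedEigenvalues.isExtendedEigenvalue_cesaro_iff hp1 hp lam]
  constructor
  · rintro ⟨s, hs0, hs1, rfl⟩
    exact ⟨s, ⟨hs0, hs1⟩, rfl⟩
  · rintro ⟨s, hs, rfl⟩
    exact ⟨s, hs.1, hs.2, rfl⟩
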